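/- Let $A$ be an $m\times n$ real or complex matrix, $m\ge n$, and let $0<a\le b\le\|A\|$, where $\|\cdot\|$ is the $2$-norm; superscript $H$ is the (conjugate) transpose. Let $S_A=\begin{bmatrix}0&A^H\\A&0\end{bmatrix}$, $l(x)=x/\|A\|$, and let $$\phi_d(x)=\sum_{j=0}^d\rho_{j,d}\,c_j\,T_j(x)$$ be the Chebyshev--Jackson series of degree $d$ of the step function of $[l(a),l(b)]$, where $T_j$ is the Chebyshev polynomial of the first kind, $c_0=\frac1\pi(\arccos l(a)-\arccos l(b))$, $c_j=\frac{2}{\pi j}\bigl(\sin(j\arccos l(a))-\sin(j\arccos l(b))\bigr)$ for $j>0$, and $$\rho_{j,d}=\frac{(d+2-j)\sin\frac{\pi}{d+2}\cos\frac{j\pi}{d+2}+\cos\frac{\pi}{d+2}\sin\frac{j\pi}{d+2}}{(d+2)\sin\frac{\pi}{d+2}}.$$ Put $P=\phi_d(l(S_A))$. Let $A=U\begin{bmatrix}\Sigma\\0\end{bmatrix}V^H$ be a singular value decomposition with singular triplets $(\sigma_i,u_i,v_i)$, $1\le i\le n$, let $p\le n$, and suppose that the triplets are labelled so that the eigenvalues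 $\phi_d(l(\sigma_1)),\dots,\phi_d(l(\sigma_p))$ of $P$ are strictly larger than the other $m+n-p$ eigenvalues of $P$, namely $\phi_d(l(\sigma_i))$ for $p<i\le n$, $\phi_d(l(-\sigma_i))$ for $1\le i\le n$, and $\phi_d(0)$ repeated $m-n$ times. Let $Q_p=\frac1{\sqrt2}\begin{bmatrix}v_1&\cdots&v_p\\u_1&\cdots&u_p\end{bmatrix}$. The CJ-FEAST SVDsolverA starts from $\tilde Q^{(0)}\in\mathbb C^{(n+m)\times p}$ (or $\mathbb R^{(n+m)\times p}$ if $A$ is real) with orthonormal columns, and $Q_p^H\tilde Q^{(0)}$ is assumed to be invertible. For $k=1,2,\dots$ it computes a thin QR decomposition $P\tilde Q^{(k-1)}=\tilde Q^{(k)}R^{(k)}$ and then applies the following projection step to $\tilde Q=\tilde Q^{(k)}$: split $\tilde Q=\begin{bmatrix}Y\\Z\end{bmatrix}$ with $Y$ having $n$ rows and $Z$ having $m$ rows, compute thin QR decompositions $Y=Q_1R_1$, $Z=Q_2R_2$ and a singular value decomposition $Q_2^HAQ_1=\bar U\tilde\Sigma\bar V^H$ with $\tilde\Sigma=\operatorname{diag}(\tilde\sigma_1,\dots,\tilde\sigma_p)$,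 and let $\tilde u_i$, $\tilde v_i$ be the $i$-th columns of $Q_2\bar U$, $Q_1\bar V$. The triplets obtained at step $k$ are denoted $(\tilde\sigma_i^{(k)},\tilde u_i^{(k)},\tilde v_i^{(k)})$. For subspaces put $\operatorname{dist}(\mathcal S,\mathcal T)=\|P_{\mathcal S}-P_{\mathcal T}\|$ with orthogonal projectors $P_{\mathcal S},P_{\mathcal T}$, let $\epsilon^{(k)}=\operatorname{dist}(\operatorname{span}\tilde Q^{(k)},\operatorname{span}Q_p)$, and let $$r(\sigma,u,v)=\begin{bmatrix}Av-\sigma u\\A^Hu-\sigma v\end{bmatrix}.$$ Then: 1. For all $k\ge1$ and $1\le i\le p$, independently of the size of $\sigma_i$, $$\|r(\tilde\sigma_i^{(k)},\tilde u_i^{(k)},\tilde v_i^{(k)})\|\le4\,\|A\|\,\epsilon^{(k)}.$$ 2. The solver is numerically backward stable in the following sense. (a) For every $\epsilon_{\rm mach}>0$ and $C\ge0$: whenever the projection step is applied to a matrix $\hat Q$ with orthonormal columns, which need not be an exact iterate, with $\operatorname{dist}(\operatorname{span}\hat Q,\operatorname{span}Q_p)\le C\epsilon_{\rm mach}$, all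 resulting triplets satisfy $\|r\|/\|A\|\le4C\epsilon_{\rm mach}$. (b) $\epsilon^{(k)}\to0$ as $k\to\infty$. (c) Consequently, for every $\epsilon_{\rm mach}>0$ there is a $K$ such that $\|r(\tilde\sigma_i^{(k)},\tilde u_i^{(k)},\tilde v_i^{(k)})\|/\|A\|\le4\epsilon_{\rm mach}$ for all $k\ge K$ and $1\le i\le p$. -/

import Mathlib

open scoped Matrix Matrix.Norms.L2Operator

noncomputable section

namespace CJFeast

/-! Every matrix norm `‖M‖` below is the spectral norm (operator norm for Euclidean vectors). -/

section Series

/-- Fourier coefficients of the step function of `[a, b] ⊆ [-1, 1]` in the Chebyshev basis. -/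
def stepCoeff (a b : ℝ) (j : ℕ) : ℝ :=
  if j = 0 then (Real.arccos a - Real.arccos b) / Real.pi
  else 2 / Real.pi * ((Real.sin (j * Real.arccos a) - Real.sin (j * Real.arccos b)) / j)

/-- Jackson damping factors. -/
def jacksonFactor (j d : ℕ) : ℝ :=
  (((d : ℝ) + 2 - j) * Real.sin (Real.pi / (d + 2)) * Real.cos (j * Real.pi / (d + 2))
      + Real.cos (Real.pi / (d + 2)) * Real.sin (j * Real.pi / (d + 2)))
    / ((d + 2) * Real.sin (Real.pi / (d + 2)))

/-- The Chebyshev--Jackson series `φ_d` of degree `d` for `[a, b] ⊆ [-1, 1]`. -/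
def chebyshevJackson (a b : ℝ) (d : ℕ) : Polynomial ℝ :=
  ∑ j ∈ Finset.range (d + 1),
    Polynomial.C (jacksonFactor j d * stepCoeff a b j) * Polynomial.Chebyshev.T ℝ (j : ℤ)

end Series

variable {𝕜 : Type*} [RCLike 𝕜] {m n p : ℕ}

/-- The augmented matrix `[0, Aᴴ; A, 0]`. -/
def augmented (A : Matrix (Fin m) (Fin n) 𝕜) : Matrix (Fin n ⊕ Fin m) (Fin n ⊕ Fin m) 𝕜 :=
  Matrix.fromBlocks 0 Aᴴ A 0

/-- The eigenvalue `φ_d(l(x))` of the approximate spectral projector belonging to the eigenvalue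
`x` of the augmented matrix; here `l(x) = x / ‖A‖`. -/
def filterValue (A : Matrix (Fin m) (Fin n) 𝕜) (a b : ℝ) (d : ℕ) (x : ℝ) : ℝ :=
  (chebyshevJackson (a / ‖A‖) (b / ‖A‖) d).eval (x / ‖A‖)

/-- The approximate spectral projector `P = φ_d(l(S_A))`. -/
def approxProjector (A : Matrix (Fin m) (Fin n) 𝕜) (a b : ℝ) (d : ℕ) :
    Matrix (Fin n ⊕ Fin m) (Fin n ⊕ Fin m) 𝕜 :=
  Polynomial.aeval ((‖A‖⁻¹ : ℝ) • augmented A) (chebyshevJackson (a / ‖A‖) (b / ‖A‖) d)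

/-- `A = U [Σ; 0] Vᴴ` is a singular value decomposition; the singular values may be labelled in
any order. -/
structure IsSVD (A : Matrix (Fin m) (Fin n) 𝕜) (U : Matrix (Fin m) (Fin m) 𝕜) (σ : Fin n → ℝ)
    (V : Matrix (Fin n) (Fin n) 𝕜) : Prop where
  unitary_left : U ∈ Matrix.unitaryGroup (Fin m) 𝕜
  unitary_right : V ∈ Matrix.unitaryGroup (Fin n) 𝕜
  nonneg : ∀ i, 0 ≤ σ i
  eq : A = U * (Matrix.of fun (i : Fin m) (j : Fin n) =>
    if (i : ℕ) = (j : ℕ) then ((σ j : ℝ) : 𝕜) else 0) * Vᴴ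

/-- The `m + n` eigenvalues of the augmented matrix, listed as `σ`, `-σ` and `m - n` zeros. -/
def augEigenvalue (m : ℕ) (σ : Fin n → ℝ) : Fin n ⊕ Fin n ⊕ Fin (m - n) → ℝ :=
  Sum.elim σ (Sum.elim (fun j => -σ j) fun _ => 0)

/-- The gap condition `γ_p > γ_{p+1}`: the labelling is such that the eigenvalues of `P` belonging
to `σ_1, …, σ_p` are strictly larger than its `m + n - p` other eigenvalues. -/
def DominantGap (A : Matrix (Fin m) (Fin n) 𝕜) (a b : ℝ) (d : ℕ) (σ : Fin n → ℝ) (p : ℕ) : Prop :=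
  ∀ i : Fin n, (i : ℕ) < p → ∀ s : Fin n ⊕ Fin n ⊕ Fin (m - n),
    (∀ j : Fin n, s = Sum.inl j → p ≤ (j : ℕ)) →
      filterValue A a b d (augEigenvalue m σ s) < filterValue A a b d (σ i)

/-- The matrix `Q_p = [V_p; U_p] / √2` of the eigenvectors of the augmented matrix belonging to
`σ_1, …, σ_p`. -/
def leadingEigenvectors (hnm : n ≤ m) (hpn : p ≤ n) (U : Matrix (Fin m) (Fin m) 𝕜)
    (V : Matrix (Fin n) (Fin n) 𝕜) : Matrix (Fin n ⊕ Fin m) (Fin p) 𝕜 :=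
  ((Real.sqrt 2)⁻¹ : ℝ) • Matrix.fromRows
    (V.submatrix id (Fin.castLE hpn)) (U.submatrix id (Fin.castLE (hpn.trans hnm)))

/-- The column space of a matrix, as a subspace of Euclidean space. -/
def colSpan {ι κ : Type*} [Fintype ι] (M : Matrix ι κ 𝕜) : Submodule 𝕜 (EuclideanSpace 𝕜 ι) :=
  Submodule.span 𝕜 (Set.range fun j => WithLp.toLp 2 fun i => M i j)

/-- The distance of two subspaces: the spectral norm of the difference of the orthogonal
projectors onto them. -/
def subspaceDist {ι : Type*} [Fintype ι] (S T : Submodule 𝕜 (EuclideanSpace 𝕜 ι)) : ℝ :=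
  ‖S.starProjection - T.starProjection‖

/-- `M = Q R` is a thin QR decomposition (`R` may be singular). -/
structure IsThinQR {ι : Type*} [Fintype ι] (M Q : Matrix ι (Fin p) 𝕜)
    (R : Matrix (Fin p) (Fin p) 𝕜) : Prop where
  orthonormal : Qᴴ * Q = 1
  upper : R.BlockTriangular id
  eq : M = Q * R

/-- `(σt, Ut, Vt)` is a possible output of the projection phase of the solver started from the
basis `Qt`: thin QR decompositions of the upper part `Y` and of the lower part `Z` of `Qt`, the
SVD of the projected matrix `Q₂ᴴ A Q₁`, and the Ritz vectors as the columns of `Ut` and `Vt`. -/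
def IsRitzOutput (A : Matrix (Fin m) (Fin n) 𝕜) (Qt : Matrix (Fin n ⊕ Fin m) (Fin p) 𝕜)
    (σt : Fin p → ℝ) (Ut : Matrix (Fin m) (Fin p) 𝕜) (Vt : Matrix (Fin n) (Fin p) 𝕜) : Prop :=
  ∃ (Q₁ : Matrix (Fin n) (Fin p) 𝕜) (R₁ : Matrix (Fin p) (Fin p) 𝕜)
    (Q₂ : Matrix (Fin m) (Fin p) 𝕜) (R₂ : Matrix (Fin p) (Fin p) 𝕜)
    (Ub Vb : Matrix (Fin p) (Fin p) 𝕜),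
    IsThinQR Qt.toRows₁ Q₁ R₁ ∧ IsThinQR Qt.toRows₂ Q₂ R₂ ∧
    IsSVD (Q₂ᴴ * A * Q₁) Ub σt Vb ∧ Ut = Q₂ * Ub ∧ Vt = Q₁ * Vb

/-- A run of the solver in exact arithmetic: `Qt k` is the orthonormal basis after `k` steps of
subspace iteration with `P`, and `(σt k, Ut k, Vt k)`, `k ≥ 1`, are the Ritz triplets computed
from it. -/
structure IsSolverRun (A : Matrix (Fin m) (Fin n) 𝕜) (a b : ℝ) (d : ℕ)
    (Qt : ℕ → Matrix (Fin n ⊕ Fin m) (Fin p) 𝕜) (σt : ℕ → Fin p → ℝ)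
    (Ut : ℕ → Matrix (Fin m) (Fin p) 𝕜) (Vt : ℕ → Matrix (Fin n) (Fin p) 𝕜) : Prop where
  init : (Qt 0)ᴴ * Qt 0 = 1
  iterate : ∀ k, ∃ R, IsThinQR (approxProjector A a b d * Qt k) (Qt (k + 1)) R
  ritz : ∀ k, 1 ≤ k → IsRitzOutput A (Qt k) (σt k) (Ut k) (Vt k)

/-- The residual `[A v - s u; Aᴴ u - s v]` of an approximate singular triplet `(s, u, v)`. -/
def svdResidual (A : Matrix (Fin m) (Fin n) 𝕜) (s : ℝ) (u : Fin m → 𝕜) (v : Fin n → 𝕜) :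
    EuclideanSpace 𝕜 (Fin m ⊕ Fin n) :=
  WithLp.toLp 2 (Sum.elim (A *ᵥ v - (s : 𝕜) • u) (Aᴴ *ᵥ u - (s : 𝕜) • v))

/-- The relative residual norms of all triplets can be brought down to `c` times any prescribed
machine precision, and stay there. -/
def ReachesPrecision (A : Matrix (Fin m) (Fin n) 𝕜) (σt : ℕ → Fin p → ℝ)
    (Ut : ℕ → Matrix (Fin m) (Fin p) 𝕜) (Vt : ℕ → Matrix (Fin n) (Fin p) 𝕜) (c : ℝ) : Prop :=
  ∀ εmach : ℝ, 0 < εmach → ∀ᶠ k in Filter.atTop, ∀ i : Fin p,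
    ‖svdResidual A (σt k i) (fun r => Ut k r i) (fun r => Vt k r i)‖ / ‖A‖ ≤ c * εmach

/-- The effect of an error of size `C * εmach` in the computed subspace: for every orthonormal
basis `Qh`, exact iterate or not, whose span is within `C * εmach` of the span of `Qp`, the
relative residual norms of the Ritz triplets extracted from `Qh` are at most `c * C * εmach`. -/
def StableUnderSubspaceError (A : Matrix (Fin m) (Fin n) 𝕜)
    (Qp : Matrix (Fin n ⊕ Fin m) (Fin p) 𝕜) (c : ℝ) : Prop :=
  ∀ C εmach : ℝ, 0 ≤ C → 0 < εmach → ∀ Qh : Matrix (Fin n ⊕ Fin m) (Fin p) 𝕜, Qhᴴ * Qh = 1 →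
    subspaceDist (colSpan Qh) (colSpan Qp) ≤ C * εmach →
    ∀ (σh : Fin p → ℝ) (Uh : Matrix (Fin m) (Fin p) 𝕜) (Vh : Matrix (Fin n) (Fin p) 𝕜),
      IsRitzOutput A Qh σh Uh Vh → ∀ i : Fin p,
        ‖svdResidual A (σh i) (fun r => Uh r i) (fun r => Vh r i)‖ / ‖A‖ ≤ c * C * εmach

end CJFeast

end

/-!
The proof rests on three facts about the matrix `Qp` of leading eigenvectors of the augmented
matrix.

*Residuals.* Let `ε` be the distance of the spans of `Qt` and `Qp`. Up to the factor `√2`, the upper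
and lower halves of `Qp` are the leading right and left singular vectors, hence these lie within
`√2 ε` of the spans of the upper and lower halves of `Qt`, and therefore of the orthonormal bases
`Q₁`, `Q₂`, whose spans contain these halves. All the bases involved have the same number `p` of
columns, so the one-sided gaps are symmetric (`norm_sub_proj_le_symm`). Singular subspaces are
mapped into each other by `A`, so `(1 - Q₂ Q₂ᴴ) A Q₁` and its counterpart for `Aᴴ` have norm at
most `2 √2 ‖A‖ ε` (`norm_mul_sub_proj_le`). These matrices, applied to the singular vectors of `Q₂ᴴ A Q₁`, are the two
components of the residual, whence the constant `√2 * 2 √2 = 4` (`norm_svdResidual_le`). Exactness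
of the iterates plays no role here.

*Nonnegativity.* The gap condition compares the eigenvalues of the approximate projector `P` without
absolute values, while the convergence of subspace iteration is governed by their moduli. The two
agree because the Jackson factors are the autocorrelations of the sequence
`sin ((k + 1) π / (d + 2))`, which makes the Jackson kernel a sum of squares
(`jacksonKernel_nonneg`); the Chebyshev--Jackson series of a step function is an integral of that
kernel and is therefore nonnegative on `[-1, 1]` (`eval_chebyshevJackson_nonneg`). In particular the
leading eigenvalues of `P` are positive.

*Convergence.* In an orthonormal eigenbasis of the augmented matrix (`augEigenbasis`), `P` is
diagonal. The iterates, normalized so that their coordinates along `Qp` form the identity, have all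
other coordinates multiplied at each step by a quotient of eigenvalues of modulus less than one
(`tendsto_subspaceIteration`).
-/

namespace CJFeast

/-! ### Nonnegativity of the Chebyshev--Jackson series -/

/-- A trigonometric polynomial whose coefficients are the autocorrelations of a real sequence `a`
is a squared modulus, here written as a sum of two squares. -/
theorem sum_autocorrelation_mul_cos (a : ℕ → ℝ) (s : ℝ) (N : ℕ) :
    ∑ j ∈ Finset.range N, (if j = 0 then (1 : ℝ) else 2) *
        (∑ k ∈ Finset.range (N - j), a k * a (k + j)) * Real.cos (j * s) =
      (∑ k ∈ Finset.range N, a k * Real.cos (k * s)) ^ 2 +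
        (∑ k ∈ Finset.range N, a k * Real.sin (k * s)) ^ 2 := by
  induction N with
  | zero => simp
  | succ N ih =>
    have hstep : ∑ j ∈ Finset.range (N + 1), (if j = 0 then (1 : ℝ) else 2) *
        (∑ k ∈ Finset.range (N + 1 - j), a k * a (k + j)) * Real.cos (j * s) =
      (∑ j ∈ Finset.range N, (if j = 0 then (1 : ℝ) else 2) *
        (∑ k ∈ Finset.range (N - j), a k * a (k + j)) * Real.cos (j * s)) +
      ∑ j ∈ Finset.range (N + 1), (if j = 0 then (1 : ℝ) else 2) *
        (a (N - j) * a N) * Real.cos (j * s) := by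
      have h0 : ∑ j ∈ Finset.range N, (if j = 0 then (1 : ℝ) else 2) *
          (∑ k ∈ Finset.range (N - j), a k * a (k + j)) * Real.cos (j * s) =
          ∑ j ∈ Finset.range (N + 1), (if j = 0 then (1 : ℝ) else 2) *
          (∑ k ∈ Finset.range (N - j), a k * a (k + j)) * Real.cos (j * s) := by
        rw [Finset.sum_range_succ _ N]; simp
      rw [h0, ← Finset.sum_add_distrib]
      refine Finset.sum_congr rfl fun j hj => ?_
      have hj' : j ≤ N := Nat.lt_succ_iff.mp (Finset.mem_range.mp hj)
      rw [Nat.succ_sub hj', Nat.succ_eq_add_one, Finset.sum_range_succ, Nat.sub_add_cancel hj']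
      ring
    have hcross : ∑ j ∈ Finset.range (N + 1), (if j = 0 then (1 : ℝ) else 2) *
        (a (N - j) * a N) * Real.cos (j * s) =
        a N ^ 2 + ∑ k ∈ Finset.range N, 2 * a k * a N *
          (Real.cos (N * s) * Real.cos (k * s) + Real.sin (N * s) * Real.sin (k * s)) := by
      rw [← Finset.sum_range_reflect, Finset.sum_range_succ]
      simp only [Nat.add_sub_cancel, Nat.sub_self]
      rw [add_comm]
      congr 1
      · simp; ring
      · refine Finset.sum_congr rfl fun k hk => ?_
        have hk' : k < N := Finset.mem_range.mp hk
        rw [if_neg (by omega), Nat.sub_sub_self hk'.le, Nat.cast_sub hk'.le, sub_mul,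
          Real.cos_sub]
        ring
    rw [hstep, hcross, ih, Finset.sum_range_succ _ N, Finset.sum_range_succ _ N]
    have hsplit : ∑ k ∈ Finset.range N, 2 * a k * a N *
          (Real.cos (N * s) * Real.cos (k * s) + Real.sin (N * s) * Real.sin (k * s)) =
        2 * a N * Real.cos (N * s) * ∑ k ∈ Finset.range N, a k * Real.cos (k * s) +
        2 * a N * Real.sin (N * s) * ∑ k ∈ Finset.range N, a k * Real.sin (k * s) := by
      rw [Finset.mul_sum, Finset.mul_sum, ← Finset.sum_add_distrib]
      exact Finset.sum_congr rfl fun k _ => by ring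
    rw [hsplit]
    linear_combination (-(a N ^ 2)) * Real.sin_sq_add_cos_sq (N * s)

/-- The sum telescopes after two applications of the product-to-sum formulas. -/
theorem sin_mul_sum_sin_mul_sin (h : ℝ) (j N : ℕ) :
    Real.sin h * ∑ k ∈ Finset.range N,
        Real.sin (((k : ℝ) + 1) * h) * Real.sin ((((k + j : ℕ) : ℝ) + 1) * h) =
      N * Real.sin h * Real.cos (j * h) / 2 -
        (Real.sin ((2 * N + 1 + j) * h) - Real.sin ((1 + j) * h)) / 4 := by
  induction N with
  | zero => simp
  | succ N ih =>
    rw [Finset.sum_range_succ, mul_add, ih]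
    have e1 : Real.cos (j * h) - Real.cos ((2 * N + 2 + j) * h) =
        2 * Real.sin (((N : ℝ) + 1) * h) * Real.sin ((((N + j : ℕ) : ℝ) + 1) * h) := by
      have h1 : (j : ℝ) * h = (((N + j : ℕ) : ℝ) + 1) * h - ((N : ℝ) + 1) * h := by
        push_cast; ring
      have h2 : (2 * N + 2 + j : ℝ) * h = (((N + j : ℕ) : ℝ) + 1) * h + ((N : ℝ) + 1) * h := by
        push_cast; ring
      rw [h1, h2, Real.cos_sub, Real.cos_add]; ring
    have e2 : Real.sin ((2 * (N + 1 : ℕ) + 1 + j) * h) - Real.sin ((2 * N + 1 + j) * h) =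
        2 * Real.cos ((2 * N + 2 + j) * h) * Real.sin h := by
      have h1 : (2 * (N + 1 : ℕ) + 1 + j : ℝ) * h = (2 * N + 2 + j) * h + h := by
        push_cast; ring
      have h2 : (2 * N + 1 + j : ℝ) * h = (2 * N + 2 + j) * h - h := by ring
      rw [h1, h2, Real.sin_sub, Real.sin_add]; ring
    push_cast at e2 ⊢
    push_cast at e1
    linear_combination (-Real.sin h / 2) * e1 + (1 / 4) * e2

theorem sin_pi_div_add_two_pos (d : ℕ) : 0 < Real.sin (Real.pi / (d + 2)) := by
  have hd : (0 : ℝ) ≤ d := d.cast_nonneg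
  apply Real.sin_pos_of_pos_of_lt_pi
  · positivity
  · rw [div_lt_iff₀ (by positivity)]
    nlinarith [Real.pi_pos]

/-- The Jackson factors are the autocorrelations of the sequence `sin ((k + 1) π / (d + 2))`. -/
theorem sum_sin_mul_sin_eq_jacksonFactor {j d : ℕ} (hj : j ≤ d) :
    ∑ k ∈ Finset.range (d + 1 - j),
        Real.sin (((k : ℝ) + 1) * (Real.pi / (d + 2))) *
          Real.sin ((((k + j : ℕ) : ℝ) + 1) * (Real.pi / (d + 2))) =
      (d + 2) / 2 * jacksonFactor j d := by
  have hs := sin_pi_div_add_two_pos d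
  have hd : (d : ℝ) + 2 ≠ 0 := by positivity
  have key := sin_mul_sum_sin_mul_sin (Real.pi / (d + 2)) j (d + 1 - j)
  have hcast : ((d + 1 - j : ℕ) : ℝ) = d + 1 - j := by
    rw [Nat.cast_sub (by omega)]; push_cast; ring
  have harg : (2 * ((d + 1 - j : ℕ) : ℝ) + 1 + j) * (Real.pi / (d + 2)) =
      2 * Real.pi - (1 + j) * (Real.pi / (d + 2)) := by
    rw [hcast]; field_simp; ring
  have harg' : (1 + j : ℝ) * (Real.pi / (d + 2)) =
      Real.pi / (d + 2) + j * (Real.pi / (d + 2)) := by ring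
  rw [harg, Real.sin_two_pi_sub, harg', Real.sin_add, hcast] at key
  apply mul_left_cancel₀ hs.ne'
  rw [key, jacksonFactor, mul_div_assoc (j : ℝ)]
  field_simp
  ring

/-- The Jackson kernel is nonnegative. -/
theorem jacksonKernel_nonneg (d : ℕ) (s : ℝ) :
    0 ≤ ∑ j ∈ Finset.range (d + 1),
      (if j = 0 then (1 : ℝ) else 2) * jacksonFactor j d * Real.cos (j * s) := by
  have h := sum_autocorrelation_mul_cos
    (fun k => Real.sin (((k : ℝ) + 1) * (Real.pi / (d + 2)))) s (d + 1)
  have h2 : ∑ j ∈ Finset.range (d + 1),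
      (if j = 0 then (1 : ℝ) else 2) * jacksonFactor j d * Real.cos (j * s) =
      2 / (d + 2) * ∑ j ∈ Finset.range (d + 1), (if j = 0 then (1 : ℝ) else 2) *
        (∑ k ∈ Finset.range (d + 1 - j), Real.sin (((k : ℝ) + 1) * (Real.pi / (d + 2))) *
          Real.sin ((((k + j : ℕ) : ℝ) + 1) * (Real.pi / (d + 2)))) * Real.cos (j * s) := by
    rw [Finset.mul_sum]
    refine Finset.sum_congr rfl fun j hj => ?_
    rw [sum_sin_mul_sin_eq_jacksonFactor (Nat.lt_succ_iff.mp (Finset.mem_range.mp hj))]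
    field_simp
  rw [h2, h]
  positivity

/-- On `[-1, 1]` the Chebyshev--Jackson series of a step function is nonnegative: with
`x = cos θ` it is the increment between `arccos b` and `arccos a` of a function whose derivative
at `t` is `1 / π` times the mean of the values of the Jackson kernel at `t + θ` and `t - θ`. -/
theorem eval_chebyshevJackson_nonneg {a b : ℝ} (hab : a ≤ b) (d : ℕ) {x : ℝ}
    (hx : x ∈ Set.Icc (-1 : ℝ) 1) : 0 ≤ (chebyshevJackson a b d).eval x := by
  obtain ⟨θ, rfl⟩ : ∃ θ, Real.cos θ = x := ⟨_, Real.cos_arccos hx.1 hx.2⟩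
  let f : ℕ → ℝ → ℝ := fun j t =>
    if j = 0 then t / Real.pi else 2 / Real.pi * (Real.sin (j * t) / j)
  let F : ℝ → ℝ := fun t =>
    ∑ j ∈ Finset.range (d + 1), jacksonFactor j d * Real.cos (j * θ) * f j t
  have hf : ∀ j t, HasDerivAt (f j)
      ((if j = 0 then (1 : ℝ) else 2) / Real.pi * Real.cos (j * t)) t := by
    intro j t
    by_cases hj : j = 0
    · subst hj
      simpa [f] using (hasDerivAt_id t).div_const Real.pi
    · have hj' : (j : ℝ) ≠ 0 := Nat.cast_ne_zero.mpr hj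
      simp only [f, hj, if_false]
      have h1 : HasDerivAt (fun t : ℝ => (j : ℝ) * t) j t := by
        simpa using (hasDerivAt_id t).const_mul (j : ℝ)
      have := (h1.sin.div_const (j : ℝ)).const_mul (2 / Real.pi)
      refine this.congr_deriv ?_
      field_simp
  have hF : ∀ t, HasDerivAt F (∑ j ∈ Finset.range (d + 1), jacksonFactor j d * Real.cos (j * θ) *
      ((if j = 0 then (1 : ℝ) else 2) / Real.pi * Real.cos (j * t))) t := fun t =>
    HasDerivAt.fun_sum fun j _ => (hf j t).const_mul _
  have hmono : Monotone F := by
    refine monotone_of_deriv_nonneg (fun t => (hF t).differentiableAt) fun t => ?_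
    rw [(hF t).deriv]
    have hk := add_nonneg (jacksonKernel_nonneg d (t + θ)) (jacksonKernel_nonneg d (t - θ))
    rw [← Finset.sum_add_distrib] at hk
    have hpos : 0 ≤ 1 / (2 * Real.pi) := by positivity
    refine (mul_nonneg hpos hk).trans_eq ?_
    rw [Finset.mul_sum]
    refine Finset.sum_congr rfl fun j _ => ?_
    rw [mul_add (j : ℝ), mul_sub (j : ℝ), Real.cos_add, Real.cos_sub]
    field_simp
    ring
  have heval : (chebyshevJackson a b d).eval (Real.cos θ) =
      F (Real.arccos a) - F (Real.arccos b) := by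
    simp only [chebyshevJackson, Polynomial.eval_finsetSum, Polynomial.eval_mul,
      Polynomial.eval_C, Polynomial.Chebyshev.T_real_cos, F, ← Finset.sum_sub_distrib]
    refine Finset.sum_congr rfl fun j _ => ?_
    by_cases hj : j = 0
    · subst hj; simp [f, stepCoeff]; ring
    · simp [f, stepCoeff, hj]; ring
  rw [heval]
  exact sub_nonneg.mpr (hmono (Real.arccos_le_arccos hab))

/-! ### Orthonormal columns and distances between column spaces -/

section
variable {𝕜 : Type*} [RCLike 𝕜] {ι κ l : Type*} [Fintype ι] [Fintype κ] [DecidableEq ι]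
  [DecidableEq κ] [Fintype l] [DecidableEq l]

omit [DecidableEq ι] in
theorem norm_le_one_of_orthonormal {Q : Matrix ι κ 𝕜} (hQ : Qᴴ * Q = 1) : ‖Q‖ ≤ 1 := by
  have h := Matrix.l2_opNorm_conjTranspose_mul_self Q
  have h1 : ‖(1 : Matrix κ κ 𝕜)‖ ≤ 1 := by
    rw [← Matrix.diagonal_one, Matrix.l2_opNorm_diagonal]
    exact (pi_norm_le_iff_of_nonneg zero_le_one).mpr fun _ => by simp
  rw [hQ] at h
  nlinarith [norm_nonneg Q]

theorem norm_conjTranspose_le_one {Q : Matrix ι κ 𝕜} (hQ : Qᴴ * Q = 1) : ‖Qᴴ‖ ≤ 1 := by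
  rw [Matrix.l2_opNorm_conjTranspose]; exact norm_le_one_of_orthonormal hQ

theorem norm_one_sub_proj_le_one {Q : Matrix ι κ 𝕜} (hQ : Qᴴ * Q = 1) :
    ‖1 - Q * Qᴴ‖ ≤ 1 := by
  have h := Matrix.l2_opNorm_conjTranspose_mul_self (1 - Q * Qᴴ)
  have hQ' : Q * Qᴴ * (Q * Qᴴ) = Q * Qᴴ := by
    rw [Matrix.mul_assoc, ← Matrix.mul_assoc Qᴴ, hQ, Matrix.one_mul]
  have e : (1 - Q * Qᴴ)ᴴ * (1 - Q * Qᴴ) = 1 - Q * Qᴴ := by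
    simp [Matrix.mul_sub, Matrix.sub_mul, hQ']
  rw [e] at h
  nlinarith [norm_nonneg (1 - Q * Qᴴ)]

omit [DecidableEq ι] [DecidableEq κ] in
theorem norm_sq_toLp_mulVec (M : Matrix ι κ 𝕜) (x : κ → 𝕜) :
    ‖WithLp.toLp 2 (M *ᵥ x)‖ ^ 2 = RCLike.re (star x ⬝ᵥ (Mᴴ * M) *ᵥ x) := by
  rw [← inner_self_eq_norm_sq (𝕜 := 𝕜), EuclideanSpace.inner_toLp_toLp, dotProduct_comm,
    Matrix.star_mulVec, ← Matrix.dotProduct_mulVec, Matrix.mulVec_mulVec]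

omit [DecidableEq ι] [DecidableEq l] in
theorem norm_sq_mulVec_add {M : Matrix ι κ 𝕜} {C : Matrix l κ 𝕜} (h : Mᴴ * M + Cᴴ * C = 1)
    (x : κ → 𝕜) :
    ‖WithLp.toLp 2 (M *ᵥ x)‖ ^ 2 + ‖WithLp.toLp 2 (C *ᵥ x)‖ ^ 2 = ‖WithLp.toLp 2 x‖ ^ 2 := by
  have h1 := norm_sq_toLp_mulVec (1 : Matrix κ κ 𝕜) x
  rw [Matrix.one_mulVec] at h1
  rw [h1, norm_sq_toLp_mulVec, norm_sq_toLp_mulVec, ← map_add, ← dotProduct_add,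
    ← Matrix.add_mulVec, h]
  simp

omit [DecidableEq ι] in
theorem norm_toLp_mulVec_le (M : Matrix ι κ 𝕜) (x : κ → 𝕜) :
    ‖WithLp.toLp 2 (M *ᵥ x)‖ ≤ ‖M‖ * ‖WithLp.toLp 2 x‖ :=
  Matrix.l2_opNorm_mulVec M (WithLp.toLp 2 x)

omit [DecidableEq ι] in
theorem norm_le_of_norm_toLp_mulVec_le {M : Matrix ι κ 𝕜} {c : ℝ} (hc : 0 ≤ c)
    (h : ∀ x, ‖WithLp.toLp 2 (M *ᵥ x)‖ ≤ c * ‖WithLp.toLp 2 x‖) : ‖M‖ ≤ c := by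
  rw [Matrix.l2_opNorm_def]
  exact ContinuousLinearMap.opNorm_le_bound _ hc fun x => h x.ofLp

omit [DecidableEq ι] in
theorem norm_toLp_col_le (M : Matrix ι κ 𝕜) (j : κ) : ‖WithLp.toLp 2 fun i => M i j‖ ≤ ‖M‖ := by
  have h := norm_toLp_mulVec_le M (Pi.single j 1)
  rw [Matrix.mulVec_single_one] at h
  have e : ‖(WithLp.toLp 2 (Pi.single j 1) : EuclideanSpace 𝕜 κ)‖ = 1 := by
    simp
  rw [e, mul_one] at h
  exact h

omit [DecidableEq κ] in
/-- A square matrix and its adjoint have the same lower bound: the inverse of the adjoint is the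
adjoint of the inverse. -/
theorem lower_bound_conjTranspose {C : Matrix κ κ 𝕜} {c : ℝ} (hc : 0 < c)
    (h : ∀ x : κ → 𝕜, c * ‖WithLp.toLp 2 x‖ ≤ ‖WithLp.toLp 2 (C *ᵥ x)‖) (x : κ → 𝕜) :
    c * ‖WithLp.toLp 2 x‖ ≤ ‖WithLp.toLp 2 (Cᴴ *ᵥ x)‖ := by
  have hinj : Function.Injective (Matrix.mulVecLin C) := by
    rw [← LinearMap.ker_eq_bot, LinearMap.ker_eq_bot']
    intro y hy
    have h1 := h y
    rw [Matrix.mulVecLin_apply] at hy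
    rw [hy] at h1
    have h2 : ‖WithLp.toLp 2 y‖ = 0 := by
      have := norm_nonneg (WithLp.toLp 2 y)
      simp only [WithLp.toLp_zero, norm_zero] at h1
      nlinarith
    simpa using h2
  obtain ⟨y, hy⟩ := LinearMap.injective_iff_surjective.mp hinj x
  rw [Matrix.mulVecLin_apply] at hy
  have h1 : ‖WithLp.toLp 2 x‖ ^ 2 ≤ ‖WithLp.toLp 2 (Cᴴ *ᵥ x)‖ * ‖WithLp.toLp 2 y‖ := by
    have e : ‖WithLp.toLp 2 x‖ ^ 2 =
        RCLike.re (inner 𝕜 (WithLp.toLp 2 (Cᴴ *ᵥ x)) (WithLp.toLp 2 y)) := by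
      rw [← inner_self_eq_norm_sq (𝕜 := 𝕜), EuclideanSpace.inner_toLp_toLp,
        EuclideanSpace.inner_toLp_toLp, Matrix.star_mulVec, Matrix.conjTranspose_conjTranspose,
        dotProduct_comm y, ← Matrix.dotProduct_mulVec, hy, dotProduct_comm]
    rw [e]
    exact re_inner_le_norm _ _
  have h2 := h y
  rw [hy] at h2
  rcases (norm_nonneg (WithLp.toLp 2 x)).eq_or_lt with h0 | h0
  · rw [← h0, mul_zero]; exact norm_nonneg _
  · refine le_of_mul_le_mul_right ?_ h0
    nlinarith [norm_nonneg (WithLp.toLp 2 (Cᴴ *ᵥ x))]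

omit [DecidableEq ι] in
/-- Pythagoras for the splitting of `V` along the span of `Q` and its orthogonal complement. -/
theorem conjTranspose_mul_self_residual {Q V : Matrix ι κ 𝕜} (hQ : Qᴴ * Q = 1)
    (hV : Vᴴ * V = 1) :
    (V - Q * (Qᴴ * V))ᴴ * (V - Q * (Qᴴ * V)) + (Qᴴ * V)ᴴ * (Qᴴ * V) = 1 := by
  have e : Qᴴ * (Q * (Qᴴ * V)) = Qᴴ * V := by rw [← Matrix.mul_assoc, hQ, Matrix.one_mul]
  simp only [Matrix.conjTranspose_sub, Matrix.conjTranspose_mul, Matrix.sub_mul, Matrix.mul_sub,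
    Matrix.conjTranspose_conjTranspose, hV, Matrix.mul_assoc, e]
  abel

/-- For two orthonormal families of the same size the two one-sided gaps between their spans
coincide. -/
theorem norm_sub_proj_le_symm {Q V : Matrix ι κ 𝕜} (hQ : Qᴴ * Q = 1) (hV : Vᴴ * V = 1) {δ : ℝ}
    (h : ‖V - Q * (Qᴴ * V)‖ ≤ δ) : ‖Q - V * (Vᴴ * Q)‖ ≤ δ := by
  have hδ : 0 ≤ δ := (norm_nonneg _).trans h
  rcases le_or_gt 1 δ with h1 | h1
  · have e : Q - V * (Vᴴ * Q) = (1 - V * Vᴴ) * Q := by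
      rw [Matrix.sub_mul, Matrix.one_mul, Matrix.mul_assoc]
    rw [e]
    calc _ ≤ ‖1 - V * Vᴴ‖ * ‖Q‖ := Matrix.l2_opNorm_mul _ _
      _ ≤ 1 * 1 := mul_le_mul (norm_one_sub_proj_le_one hV) (norm_le_one_of_orthonormal hQ)
          (norm_nonneg _) zero_le_one
      _ ≤ δ := by linarith
  · have hpos : 0 < 1 - δ ^ 2 := by nlinarith
    have hlow : ∀ x : κ → 𝕜, √(1 - δ ^ 2) * ‖WithLp.toLp 2 x‖ ≤
        ‖WithLp.toLp 2 ((Qᴴ * V) *ᵥ x)‖ := by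
      intro x
      have h2 := norm_sq_mulVec_add (conjTranspose_mul_self_residual hQ hV) x
      have h3 := (norm_toLp_mulVec_le (V - Q * (Qᴴ * V)) x).trans
        (mul_le_mul_of_nonneg_right h (norm_nonneg _))
      have h4 := pow_le_pow_left₀ (norm_nonneg _) h3 2
      refine (sq_le_sq₀ (by positivity) (norm_nonneg _)).mp ?_
      rw [mul_pow, Real.sq_sqrt hpos.le]
      nlinarith
    have hC : (Qᴴ * V)ᴴ = Vᴴ * Q := by simp
    refine norm_le_of_norm_toLp_mulVec_le hδ fun x => ?_
    have h2 := norm_sq_mulVec_add (conjTranspose_mul_self_residual hV hQ) x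
    have h3 := lower_bound_conjTranspose (Real.sqrt_pos.mpr hpos) hlow x
    rw [hC] at h3
    have h4 := pow_le_pow_left₀ (by positivity) h3 2
    rw [mul_pow, Real.sq_sqrt hpos.le] at h4
    refine (sq_le_sq₀ (by positivity) (by positivity)).mp ?_
    nlinarith

theorem starProjection_colSpan {Q : Matrix ι κ 𝕜} (hQ : Qᴴ * Q = 1) :
    (colSpan Q).starProjection = Matrix.toEuclideanCLM (n := ι) (𝕜 := 𝕜) (Q * Qᴴ) := by
  have hmem : ∀ y : κ → 𝕜, WithLp.toLp 2 (Q *ᵥ y) ∈ colSpan Q := by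
    intro y
    have e : WithLp.toLp 2 (Q *ᵥ y) = ∑ j, y j • WithLp.toLp 2 fun i => Q i j := by
      ext i
      simp [Matrix.mulVec, dotProduct, mul_comm]
    rw [e]
    exact Submodule.sum_mem _ fun j _ =>
      Submodule.smul_mem _ _ (Submodule.subset_span ⟨j, rfl⟩)
  ext1 x
  refine Submodule.eq_starProjection_of_mem_orthogonal (K := colSpan Q) ?_ ?_
  · rw [← WithLp.toLp_ofLp 2 x, Matrix.toEuclideanCLM_toLp, ← Matrix.mulVec_mulVec]
    exact hmem _
  · rw [colSpan, Submodule.mem_orthogonal]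
    intro u hu
    induction hu using Submodule.span_induction with
    | mem u hu =>
      obtain ⟨j, rfl⟩ := hu
      have e : x - Matrix.toEuclideanCLM (n := ι) (𝕜 := 𝕜) (Q * Qᴴ) x =
          WithLp.toLp 2 ((1 - Q * Qᴴ) *ᵥ x.ofLp) := by
        ext i
        simp [Matrix.sub_mulVec]
      have e0 : Qᴴ * (1 - Q * Qᴴ) = 0 := by
        rw [Matrix.mul_sub, ← Matrix.mul_assoc, hQ]; simp
      have e1 : (Qᴴ *ᵥ ((1 - Q * Qᴴ) *ᵥ x.ofLp)) j = 0 := by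
        rw [Matrix.mulVec_mulVec, e0]; simp
      rw [e, EuclideanSpace.inner_toLp_toLp, dotProduct_comm]
      exact e1
    | zero => simp
    | add u v _ _ h1 h2 => rw [inner_add_left, h1, h2, add_zero]
    | smul c u _ h1 => rw [inner_smul_left, h1, mul_zero]

theorem subspaceDist_colSpan {Q V : Matrix ι κ 𝕜} (hQ : Qᴴ * Q = 1) (hV : Vᴴ * V = 1) :
    subspaceDist (colSpan Q) (colSpan V) = ‖Q * Qᴴ - V * Vᴴ‖ := by
  rw [subspaceDist, starProjection_colSpan hQ, starProjection_colSpan hV, ← map_sub,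
    Matrix.l2_opNorm_toEuclideanCLM]

theorem norm_sub_proj_le_subspaceDist {Q V : Matrix ι κ 𝕜} (hQ : Qᴴ * Q = 1) (hV : Vᴴ * V = 1) :
    ‖V - Q * (Qᴴ * V)‖ ≤ subspaceDist (colSpan Q) (colSpan V) := by
  have e : V - Q * (Qᴴ * V) = -((Q * Qᴴ - V * Vᴴ) * V) := by
    rw [Matrix.sub_mul, Matrix.mul_assoc V, hV, Matrix.mul_one, Matrix.mul_assoc, neg_sub]
  rw [subspaceDist_colSpan hQ hV, e, norm_neg]
  exact (Matrix.l2_opNorm_mul _ _).trans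
    (mul_le_of_le_one_right (norm_nonneg _) (norm_le_one_of_orthonormal hV))

theorem subspaceDist_le_two_mul {Q V : Matrix ι κ 𝕜} (hQ : Qᴴ * Q = 1) (hV : Vᴴ * V = 1) :
    subspaceDist (colSpan Q) (colSpan V) ≤ 2 * ‖Q - V * (Vᴴ * Q)‖ := by
  have h1 := norm_sub_proj_le_symm hV hQ le_rfl
  -- `P_Q - P_V = (1 - P_V) P_Q - P_V (1 - P_Q)`, and the last term is `((1 - P_Q) P_V)ᴴ`.
  have e : Q * Qᴴ - V * Vᴴ = (Q - V * (Vᴴ * Q)) * Qᴴ - V * (V - Q * (Qᴴ * V))ᴴ := by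
    simp only [Matrix.conjTranspose_sub, Matrix.conjTranspose_mul, Matrix.sub_mul, Matrix.mul_sub,
      Matrix.conjTranspose_conjTranspose, Matrix.mul_assoc]
    abel
  rw [subspaceDist_colSpan hQ hV, e]
  have h2 := (Matrix.l2_opNorm_mul (Q - V * (Vᴴ * Q)) Qᴴ).trans
    (mul_le_of_le_one_right (norm_nonneg _) (norm_conjTranspose_le_one hQ))
  have h3 := (Matrix.l2_opNorm_mul V (V - Q * (Qᴴ * V))ᴴ).trans
    (mul_le_of_le_one_left (norm_nonneg _) (norm_le_one_of_orthonormal hV))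
  rw [Matrix.l2_opNorm_conjTranspose] at h3
  linarith [norm_sub_le ((Q - V * (Vᴴ * Q)) * Qᴴ) (V * (V - Q * (Qᴴ * V))ᴴ)]

omit [DecidableEq ι] [DecidableEq κ] in
theorem norm_toRows₁_le (M : Matrix (ι ⊕ κ) l 𝕜) : ‖M.toRows₁‖ ≤ ‖M‖ := by
  refine norm_le_of_norm_toLp_mulVec_le (norm_nonneg _) fun x => ?_
  refine le_trans ?_ (norm_toLp_mulVec_le M x)
  rw [EuclideanSpace.norm_eq, EuclideanSpace.norm_eq]
  refine Real.sqrt_le_sqrt ?_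
  rw [Fintype.sum_sum_type]
  exact le_add_of_nonneg_right (by positivity)

omit [DecidableEq ι] [DecidableEq κ] in
theorem norm_toRows₂_le (M : Matrix (ι ⊕ κ) l 𝕜) : ‖M.toRows₂‖ ≤ ‖M‖ := by
  refine norm_le_of_norm_toLp_mulVec_le (norm_nonneg _) fun x => ?_
  refine le_trans ?_ (norm_toLp_mulVec_le M x)
  rw [EuclideanSpace.norm_eq, EuclideanSpace.norm_eq]
  refine Real.sqrt_le_sqrt ?_
  rw [Fintype.sum_sum_type]
  exact le_add_of_nonneg_left (by positivity)

/-- The orthogonal projection of the columns of `V` onto the span of `Q` is at least as close to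
`V` as any other matrix `Q * B` with columns in that span. -/
theorem norm_sub_proj_le_of_norm_sub_le {Q V : Matrix ι κ 𝕜} (hQ : Qᴴ * Q = 1)
    (B : Matrix κ κ 𝕜) : ‖V - Q * (Qᴴ * V)‖ ≤ ‖V - Q * B‖ := by
  have e : V - Q * (Qᴴ * V) = (1 - Q * Qᴴ) * (V - Q * B) := by
    have : Q * Qᴴ * (Q * B) = Q * B := by
      rw [Matrix.mul_assoc, ← Matrix.mul_assoc Qᴴ, hQ, Matrix.one_mul]
    rw [Matrix.sub_mul, Matrix.mul_sub (Q * Qᴴ), this, Matrix.one_mul, Matrix.mul_assoc]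
    abel
  rw [e]
  exact (Matrix.l2_opNorm_mul _ _).trans
    (mul_le_of_le_one_left (norm_nonneg _) (norm_one_sub_proj_le_one hQ))

/-- If `Q₁` and `Q₂` are `η`-close to a pair of singular subspaces of `A`, then `A` maps the span
of `Q₁` into the span of `Q₂` up to an error `2 ‖A‖ η`. -/
theorem norm_mul_sub_proj_le {A : Matrix ι l 𝕜} {Q₁ V : Matrix l κ 𝕜} {Q₂ U : Matrix ι κ 𝕜}
    (hQ₁ : Q₁ᴴ * Q₁ = 1) (hV : Vᴴ * V = 1) (hQ₂ : Q₂ᴴ * Q₂ = 1) (hU : Uᴴ * U = 1)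
    {D : Matrix κ κ 𝕜} (hAV : A * V = U * D) {η : ℝ}
    (h₁ : ‖Q₁ - V * (Vᴴ * Q₁)‖ ≤ η) (h₂ : ‖U - Q₂ * (Q₂ᴴ * U)‖ ≤ η) :
    ‖A * Q₁ - Q₂ * (Q₂ᴴ * A * Q₁)‖ ≤ 2 * ‖A‖ * η := by
  have hη : 0 ≤ η := (norm_nonneg _).trans h₁
  have hD : D = Uᴴ * (A * V) := by rw [hAV, ← Matrix.mul_assoc, hU, Matrix.one_mul]
  have hDn : ‖D‖ ≤ ‖A‖ := by
    rw [hD]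
    calc _ ≤ ‖Uᴴ‖ * ‖A * V‖ := Matrix.l2_opNorm_mul _ _
      _ ≤ ‖A * V‖ := mul_le_of_le_one_left (norm_nonneg _) (norm_conjTranspose_le_one hU)
      _ ≤ ‖A‖ * ‖V‖ := Matrix.l2_opNorm_mul _ _
      _ ≤ ‖A‖ := mul_le_of_le_one_right (norm_nonneg _) (norm_le_one_of_orthonormal hV)
  have e : A * Q₁ - Q₂ * (Q₂ᴴ * A * Q₁) =
      (1 - Q₂ * Q₂ᴴ) * (A * (Q₁ - V * (Vᴴ * Q₁))) +
        (U - Q₂ * (Q₂ᴴ * U)) * (D * (Vᴴ * Q₁)) := by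
    have e1 : A * (V * (Vᴴ * Q₁)) = U * (D * (Vᴴ * Q₁)) := by
      rw [← Matrix.mul_assoc, hAV, Matrix.mul_assoc]
    simp only [Matrix.sub_mul, Matrix.mul_sub, Matrix.one_mul, e1, Matrix.mul_assoc]
    abel
  have hVQ : ‖Vᴴ * Q₁‖ ≤ 1 := (Matrix.l2_opNorm_mul _ _).trans
    (mul_le_one₀ (norm_conjTranspose_le_one hV) (norm_nonneg _) (norm_le_one_of_orthonormal hQ₁))
  have b1 : ‖(1 - Q₂ * Q₂ᴴ) * (A * (Q₁ - V * (Vᴴ * Q₁)))‖ ≤ ‖A‖ * η :=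
    calc _ ≤ ‖1 - Q₂ * Q₂ᴴ‖ * ‖A * (Q₁ - V * (Vᴴ * Q₁))‖ := Matrix.l2_opNorm_mul _ _
      _ ≤ ‖A * (Q₁ - V * (Vᴴ * Q₁))‖ :=
        mul_le_of_le_one_left (norm_nonneg _) (norm_one_sub_proj_le_one hQ₂)
      _ ≤ ‖A‖ * ‖Q₁ - V * (Vᴴ * Q₁)‖ := Matrix.l2_opNorm_mul _ _
      _ ≤ ‖A‖ * η := by gcongr
  have b2 : ‖(U - Q₂ * (Q₂ᴴ * U)) * (D * (Vᴴ * Q₁))‖ ≤ η * ‖A‖ :=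
    calc _ ≤ ‖U - Q₂ * (Q₂ᴴ * U)‖ * ‖D * (Vᴴ * Q₁)‖ := Matrix.l2_opNorm_mul _ _
      _ ≤ η * ‖A‖ := by
        gcongr
        exact (Matrix.l2_opNorm_mul _ _).trans
          ((mul_le_of_le_one_right (norm_nonneg _) hVQ).trans hDn)
  rw [e]
  linarith [norm_add_le ((1 - Q₂ * Q₂ᴴ) * (A * (Q₁ - V * (Vᴴ * Q₁))))
    ((U - Q₂ * (Q₂ᴴ * U)) * (D * (Vᴴ * Q₁)))]

end

/-! ### Singular value decompositions -/

section
variable {𝕜 : Type*} [RCLike 𝕜] {m n p : ℕ}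

/-- The first `n` left singular vectors. -/
def leftHead (hnm : n ≤ m) (U : Matrix (Fin m) (Fin m) 𝕜) : Matrix (Fin m) (Fin n) 𝕜 :=
  U.submatrix id (Fin.castLE hnm)

theorem conjTranspose_submatrix_mul_submatrix {ι κ l r : Type*} [Fintype ι] (M : Matrix ι κ 𝕜)
    (f : l → κ) (g : r → κ) :
    (M.submatrix id f)ᴴ * M.submatrix id g = (Mᴴ * M).submatrix f g := by
  ext i j
  simp [Matrix.mul_apply]

theorem leftHead_orthonormal (hnm : n ≤ m) {U : Matrix (Fin m) (Fin m) 𝕜} (hU : Uᴴ * U = 1) :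
    (leftHead hnm U)ᴴ * leftHead hnm U = 1 := by
  rw [leftHead, conjTranspose_submatrix_mul_submatrix, hU]
  exact Matrix.submatrix_one _ (Fin.castLE_injective hnm)

theorem IsSVD.mul_right_eq_leftHead (hnm : n ≤ m) {A : Matrix (Fin m) (Fin n) 𝕜}
    {U : Matrix (Fin m) (Fin m) 𝕜} {σ : Fin n → ℝ} {V : Matrix (Fin n) (Fin n) 𝕜}
    (h : IsSVD A U σ V) : A * V = leftHead hnm U * Matrix.diagonal fun i => (σ i : 𝕜) := by
  have e := h.eq
  have hV : Vᴴ * V = 1 := Matrix.mem_unitaryGroup_iff'.mp h.unitary_right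
  rw [e, Matrix.mul_assoc, hV, Matrix.mul_one]
  ext r j
  rw [Matrix.mul_diagonal, Matrix.mul_apply, Finset.sum_eq_single (Fin.castLE hnm j)]
  · simp [leftHead]
  · intro i _ hi
    have : (i : ℕ) ≠ (j : ℕ) := fun h => hi (Fin.ext (by simpa using h))
    simp [this]
  · simp

theorem IsSVD.conjTranspose_mul_apply {A : Matrix (Fin m) (Fin n) 𝕜}
    {U : Matrix (Fin m) (Fin m) 𝕜} {σ : Fin n → ℝ} {V : Matrix (Fin n) (Fin n) 𝕜}
    (h : IsSVD A U σ V) (r : Fin n) (i : Fin m) :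
    (Aᴴ * U) r i = ∑ j, V r j * if (i : ℕ) = (j : ℕ) then (σ j : 𝕜) else 0 := by
  have e := congrArg Matrix.conjTranspose h.eq
  have hU : Uᴴ * U = 1 := Matrix.mem_unitaryGroup_iff'.mp h.unitary_left
  rw [Matrix.conjTranspose_mul, Matrix.conjTranspose_mul, Matrix.conjTranspose_conjTranspose] at e
  rw [e, Matrix.mul_assoc, Matrix.mul_assoc, hU, Matrix.mul_one, Matrix.mul_apply]
  refine Finset.sum_congr rfl fun j _ => ?_
  rw [Matrix.conjTranspose_apply, Matrix.of_apply]
  split_ifs <;> simp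

theorem IsSVD.conjTranspose_mul_leftHead (hnm : n ≤ m) {A : Matrix (Fin m) (Fin n) 𝕜}
    {U : Matrix (Fin m) (Fin m) 𝕜} {σ : Fin n → ℝ} {V : Matrix (Fin n) (Fin n) 𝕜}
    (h : IsSVD A U σ V) :
    Aᴴ * leftHead hnm U = V * Matrix.diagonal fun i => (σ i : 𝕜) := by
  ext r i
  rw [Matrix.mul_diagonal]
  refine (h.conjTranspose_mul_apply r (Fin.castLE hnm i)).trans ?_
  rw [Finset.sum_eq_single i]
  · simp
  · intro j _ hj
    have : (i : ℕ) ≠ (j : ℕ) := fun h => hj (Fin.ext h.symm)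
    simp [this]
  · simp

/-! ### Residuals of the Ritz triplets -/

/-- The residual bound in terms of the one-sided gap `δ` between the span of the eigenvectors
`[Vp; Up] / √2` and the span of `Qt`. Each half of the eigenvectors, rescaled by `√2`, is
`√2 δ`-close to the span of the matching half of `Qt`; the two components of the residual are
then at most `2 √2 ‖A‖ δ` each. -/
theorem norm_svdResidual_le {A : Matrix (Fin m) (Fin n) 𝕜} {Up : Matrix (Fin m) (Fin p) 𝕜}
    {Vp : Matrix (Fin n) (Fin p) 𝕜} (hU : Upᴴ * Up = 1) (hV : Vpᴴ * Vp = 1)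
    {D : Matrix (Fin p) (Fin p) 𝕜} (hAV : A * Vp = Up * D) (hAU : Aᴴ * Up = Vp * D)
    {Qp Qt : Matrix (Fin n ⊕ Fin m) (Fin p) 𝕜}
    (hQp : Qp = ((Real.sqrt 2)⁻¹ : ℝ) • Matrix.fromRows Vp Up) {δ : ℝ}
    (hδ : ‖Qp - Qt * (Qtᴴ * Qp)‖ ≤ δ) {σt : Fin p → ℝ} {Ut : Matrix (Fin m) (Fin p) 𝕜}
    {Vt : Matrix (Fin n) (Fin p) 𝕜} (hR : IsRitzOutput A Qt σt Ut Vt) (i : Fin p) :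
    ‖svdResidual A (σt i) (fun r => Ut r i) (fun r => Vt r i)‖ ≤ 4 * ‖A‖ * δ := by
  obtain ⟨Q₁, R₁, Q₂, R₂, Ub, Vb, hY, hZ, hsvd, rfl, rfl⟩ := hR
  have hδ0 : 0 ≤ δ := (norm_nonneg _).trans hδ
  have hs2 : (0 : ℝ) < √2 := by positivity
  set W := √2 • (Qtᴴ * Qp) with hW
  have hscale : √2 • (Qp - Qt * (Qtᴴ * Qp)) = Matrix.fromRows Vp Up - Qt * W := by
    rw [smul_sub, hW, Matrix.mul_smul, hQp, smul_smul, mul_inv_cancel₀ hs2.ne', one_smul]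
  have hbound : ‖Matrix.fromRows Vp Up - Qt * W‖ ≤ √2 * δ := by
    rw [← hscale, RCLike.real_smul_eq_coe_smul (K := 𝕜), norm_smul, RCLike.norm_ofReal,
      abs_of_pos hs2]
    gcongr
  have hV1 : ‖Vp - Q₁ * (Q₁ᴴ * Vp)‖ ≤ √2 * δ := by
    refine (norm_sub_proj_le_of_norm_sub_le hY.orthonormal (R₁ * W)).trans ?_
    have e : Vp - Q₁ * (R₁ * W) = (Matrix.fromRows Vp Up - Qt * W).toRows₁ := by
      rw [← Matrix.mul_assoc, ← hY.eq]; rfl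
    rw [e]
    exact (norm_toRows₁_le _).trans hbound
  have hU1 : ‖Up - Q₂ * (Q₂ᴴ * Up)‖ ≤ √2 * δ := by
    refine (norm_sub_proj_le_of_norm_sub_le hZ.orthonormal (R₂ * W)).trans ?_
    have e : Up - Q₂ * (R₂ * W) = (Matrix.fromRows Vp Up - Qt * W).toRows₂ := by
      rw [← Matrix.mul_assoc, ← hZ.eq]; rfl
    rw [e]
    exact (norm_toRows₂_le _).trans hbound
  have hV2 := norm_sub_proj_le_symm hY.orthonormal hV hV1
  have hU2 := norm_sub_proj_le_symm hZ.orthonormal hU hU1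
  have b1 := norm_mul_sub_proj_le hY.orthonormal hV hZ.orthonormal hU hAV hV2 hU1
  have b2 := norm_mul_sub_proj_le hZ.orthonormal hU hY.orthonormal hV hAU hU2 hV1
  rw [Matrix.l2_opNorm_conjTranspose] at b2
  have hUb : ‖Ub‖ ≤ 1 := norm_le_one_of_orthonormal
    (by rw [← Matrix.star_eq_conjTranspose]; exact Matrix.mem_unitaryGroup_iff'.mp hsvd.unitary_left)
  have hVb : ‖Vb‖ ≤ 1 := norm_le_one_of_orthonormal
    (by rw [← Matrix.star_eq_conjTranspose]; exact Matrix.mem_unitaryGroup_iff'.mp hsvd.unitary_right)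
  -- The middle factor of `hsvd` is square, and `leftHead` of a square matrix is the matrix itself.
  have hs : (Q₂ᴴ * A * Q₁) * Vb = Ub * Matrix.diagonal fun i => (σt i : 𝕜) :=
    hsvd.mul_right_eq_leftHead le_rfl
  have hs' : (Q₂ᴴ * A * Q₁)ᴴ * Ub = Vb * Matrix.diagonal fun i => (σt i : 𝕜) :=
    hsvd.conjTranspose_mul_leftHead le_rfl
  have c1 : A *ᵥ (fun r => (Q₁ * Vb) r i) - (σt i : 𝕜) • (fun r => (Q₂ * Ub) r i) =
      fun r => ((A * Q₁ - Q₂ * (Q₂ᴴ * A * Q₁)) * Vb) r i := by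
    have e : (A * Q₁ - Q₂ * (Q₂ᴴ * A * Q₁)) * Vb =
        A * (Q₁ * Vb) - Q₂ * Ub * Matrix.diagonal fun i => (σt i : 𝕜) := by
      rw [Matrix.sub_mul, Matrix.mul_assoc Q₂ _ Vb, hs]
      simp only [Matrix.mul_assoc]
    rw [e]
    ext r
    simp only [Matrix.sub_apply, Matrix.mul_diagonal, Matrix.mul_apply (M := A), Matrix.mulVec,
      dotProduct, Pi.sub_apply, Pi.smul_apply, smul_eq_mul, mul_comm (σt i : 𝕜)]
  have c2 : Aᴴ *ᵥ (fun r => (Q₂ * Ub) r i) - (σt i : 𝕜) • (fun r => (Q₁ * Vb) r i) =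
      fun r => ((Aᴴ * Q₂ - Q₁ * (Q₁ᴴ * Aᴴ * Q₂)) * Ub) r i := by
    have hs : (Q₁ᴴ * Aᴴ * Q₂) * Ub = Vb * Matrix.diagonal fun i => (σt i : 𝕜) := by
      rw [← hs']
      simp [Matrix.conjTranspose_mul, Matrix.mul_assoc]
    have e : (Aᴴ * Q₂ - Q₁ * (Q₁ᴴ * Aᴴ * Q₂)) * Ub =
        Aᴴ * (Q₂ * Ub) - Q₁ * Vb * Matrix.diagonal fun i => (σt i : 𝕜) := by
      rw [Matrix.sub_mul, Matrix.mul_assoc Q₁ _ Ub, hs]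
      simp only [Matrix.mul_assoc]
    rw [e]
    ext r
    simp only [Matrix.sub_apply, Matrix.mul_diagonal, Matrix.mul_apply (M := Aᴴ), Matrix.mulVec,
      dotProduct, Pi.sub_apply, Pi.smul_apply, smul_eq_mul, mul_comm (σt i : 𝕜)]
  have d1 := ((norm_toLp_col_le ((A * Q₁ - Q₂ * (Q₂ᴴ * A * Q₁)) * Vb) i).trans
    ((Matrix.l2_opNorm_mul _ _).trans (mul_le_of_le_one_right (norm_nonneg _) hVb))).trans b1
  have d2 := ((norm_toLp_col_le ((Aᴴ * Q₂ - Q₁ * (Q₁ᴴ * Aᴴ * Q₂)) * Ub) i).trans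
    ((Matrix.l2_opNorm_mul _ _).trans (mul_le_of_le_one_right (norm_nonneg _) hUb))).trans b2
  rw [← c1] at d1
  rw [← c2] at d2
  refine (sq_le_sq₀ (by positivity) (by positivity)).mp ?_
  have hsq : ∀ (x : Fin m → 𝕜) (y : Fin n → 𝕜),
      ‖(WithLp.toLp 2 (Sum.elim x y) : EuclideanSpace 𝕜 (Fin m ⊕ Fin n))‖ ^ 2 =
        ‖WithLp.toLp 2 x‖ ^ 2 + ‖WithLp.toLp 2 y‖ ^ 2 := by
    intro x y
    simp [EuclideanSpace.norm_sq_eq, Fintype.sum_sum_type]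
  rw [svdResidual, hsq]
  have f1 := pow_le_pow_left₀ (norm_nonneg _) d1 2
  have f2 := pow_le_pow_left₀ (norm_nonneg _) d2 2
  have f3 : (2 * ‖A‖ * (√2 * δ)) ^ 2 = 8 * ‖A‖ ^ 2 * δ ^ 2 := by
    have : √2 ^ 2 = 2 := Real.sq_sqrt (by norm_num)
    linear_combination 4 * ‖A‖ ^ 2 * δ ^ 2 * this
  linear_combination f1 + f2 + 2 * f3

end

/-! ### Spectral decomposition of the approximate projector -/

section
variable {𝕜 : Type*} [RCLike 𝕜]

theorem aeval_mul_eq_mul_diagonal {ι s : Type*} [Fintype ι] [DecidableEq ι] [Fintype s]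
    [DecidableEq s] {M : Matrix ι ι 𝕜} {W : Matrix ι s 𝕜} {lam : s → ℝ}
    (h : M * W = W * Matrix.diagonal fun t => (lam t : 𝕜)) (q : Polynomial ℝ) :
    Polynomial.aeval M q * W = W * Matrix.diagonal fun t => ((q.eval (lam t) : ℝ) : 𝕜) := by
  induction q using Polynomial.induction_on' with
  | add q r hq hr =>
    rw [map_add, Matrix.add_mul, hq, hr, ← Matrix.mul_add, Matrix.diagonal_add]
    simp
  | monomial k c =>
    have hpow : ∀ k : ℕ, M ^ k * W = W * Matrix.diagonal fun t => ((lam t ^ k : ℝ) : 𝕜) := by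
      intro k
      induction k with
      | zero => simp
      | succ k ih =>
        rw [pow_succ', Matrix.mul_assoc, ih, ← Matrix.mul_assoc, h, Matrix.mul_assoc,
          Matrix.diagonal_mul_diagonal]
        simp [pow_succ']
    rw [Polynomial.aeval_monomial, ← Algebra.smul_def, Matrix.smul_mul, hpow, ← Matrix.mul_smul]
    congr 1
    ext i j
    by_cases hij : i = j
    · subst hij; simp [RCLike.real_smul_eq_coe_mul]
    · simp [hij]

variable {m n p : ℕ}

/-- The last `m - n` left singular vectors. -/
def leftTail (U : Matrix (Fin m) (Fin m) 𝕜) : Matrix (Fin m) (Fin (m - n)) 𝕜 :=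
  U.submatrix id fun j => ⟨n + j, by omega⟩

/-- The eigenvectors `[v; u] / √2`, `[v; -u] / √2` and `[0; u]` of the augmented matrix, ordered
as the eigenvalues in `augEigenvalue`. -/
noncomputable def augEigenbasis (hnm : n ≤ m) (U : Matrix (Fin m) (Fin m) 𝕜)
    (V : Matrix (Fin n) (Fin n) 𝕜) :
    Matrix (Fin n ⊕ Fin m) (Fin n ⊕ Fin n ⊕ Fin (m - n)) 𝕜 :=
  Matrix.fromCols (((Real.sqrt 2)⁻¹ : ℝ) • Matrix.fromRows V (leftHead hnm U))
    (Matrix.fromCols (((Real.sqrt 2)⁻¹ : ℝ) • Matrix.fromRows V (-leftHead hnm U))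
      (Matrix.fromRows 0 (leftTail U)))

theorem leadingEigenvectors_eq_submatrix (hnm : n ≤ m) (hpn : p ≤ n)
    (U : Matrix (Fin m) (Fin m) 𝕜) (V : Matrix (Fin n) (Fin n) 𝕜) :
    leadingEigenvectors hnm hpn U V =
      (augEigenbasis hnm U V).submatrix id fun i => Sum.inl (Fin.castLE hpn i) := by
  ext i j
  rcases i with i | i <;> simp [leadingEigenvectors, augEigenbasis, leftHead]

theorem leftTail_orthonormal {U : Matrix (Fin m) (Fin m) 𝕜} (hU : Uᴴ * U = 1) :
    (leftTail (n := n) U)ᴴ * leftTail (n := n) U = 1 := by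
  rw [leftTail, conjTranspose_submatrix_mul_submatrix, hU]
  refine Matrix.submatrix_one _ fun i j h => ?_
  simp only [Fin.mk.injEq] at h
  exact Fin.ext (by omega)

theorem leftHead_leftTail_orthogonal (hnm : n ≤ m) {U : Matrix (Fin m) (Fin m) 𝕜}
    (hU : Uᴴ * U = 1) : (leftHead hnm U)ᴴ * leftTail (n := n) U = 0 := by
  rw [leftHead, leftTail, conjTranspose_submatrix_mul_submatrix, hU]
  ext i j
  rw [Matrix.submatrix_apply, Matrix.one_apply_ne, Matrix.zero_apply]
  intro h
  have := congrArg Fin.val h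
  simp only [Fin.val_castLE] at this
  omega

theorem smul_fromRows {ι κ l : Type*} (c : ℝ) (X : Matrix ι l 𝕜) (Y : Matrix κ l 𝕜) :
    c • Matrix.fromRows X Y = Matrix.fromRows (c • X) (c • Y) := by
  ext (i | i) j <;> rfl

theorem augEigenbasis_orthonormal (hnm : n ≤ m) {U : Matrix (Fin m) (Fin m) 𝕜}
    {V : Matrix (Fin n) (Fin n) 𝕜} (hU : Uᴴ * U = 1) (hV : Vᴴ * V = 1) :
    (augEigenbasis hnm U V)ᴴ * augEigenbasis hnm U V = 1 := by
  have h1 := leftHead_orthonormal hnm hU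
  have h2 := leftTail_orthonormal (n := n) hU
  have h3 := leftHead_leftTail_orthogonal hnm hU
  have h4 : (leftTail (n := n) U)ᴴ * leftHead hnm U = 0 := by
    rw [← Matrix.conjTranspose_conjTranspose (leftHead hnm U), ← Matrix.conjTranspose_mul, h3,
      Matrix.conjTranspose_zero]
  have h5 : ((Real.sqrt 2)⁻¹ : ℝ) • ((Real.sqrt 2)⁻¹ : ℝ) • ((1 : Matrix (Fin n) (Fin n) 𝕜) + 1) =
      1 := by
    have : ((Real.sqrt 2)⁻¹ * (Real.sqrt 2)⁻¹ : ℝ) * 2 = 1 := by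
      rw [← mul_inv, Real.mul_self_sqrt (by norm_num)]; norm_num
    rw [← two_smul ℝ, smul_smul, smul_smul, this, one_smul]
  simp only [augEigenbasis, Matrix.conjTranspose_fromCols_eq_fromRows_conjTranspose,
    Matrix.conjTranspose_smul, Matrix.conjTranspose_fromRows_eq_fromCols_conjTranspose,
    Matrix.fromRows_mul, Matrix.mul_fromCols, Matrix.smul_mul, smul_fromRows,
    Matrix.mul_smul, Matrix.fromCols_mul_fromRows, hV, h1, h2, h3, h4, star_trivial, h5,
    Matrix.conjTranspose_neg, Matrix.neg_mul, Matrix.mul_neg, neg_neg, smul_neg, add_neg_cancel,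
    smul_zero,
    Matrix.conjTranspose_zero, Matrix.mul_zero, Matrix.zero_mul, add_zero, zero_add, neg_zero,
    Matrix.fromRows_zero, ← smul_add]
  ext (i | i | i) (j | j | j) <;> simp [Matrix.one_apply]

theorem IsSVD.conjTranspose_mul_leftTail {A : Matrix (Fin m) (Fin n) 𝕜}
    {U : Matrix (Fin m) (Fin m) 𝕜} {σ : Fin n → ℝ} {V : Matrix (Fin n) (Fin n) 𝕜}
    (h : IsSVD A U σ V) : Aᴴ * leftTail (n := n) U = 0 := by
  ext r i
  refine (h.conjTranspose_mul_apply r ⟨n + i, by omega⟩).trans ?_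
  refine Finset.sum_eq_zero fun j _ => ?_
  have : n + (i : ℕ) ≠ (j : ℕ) := by omega
  simp [this]

theorem augmented_mul_augEigenbasis (hnm : n ≤ m) {A : Matrix (Fin m) (Fin n) 𝕜}
    {U : Matrix (Fin m) (Fin m) 𝕜} {σ : Fin n → ℝ} {V : Matrix (Fin n) (Fin n) 𝕜}
    (h : IsSVD A U σ V) :
    augmented A * augEigenbasis hnm U V =
      augEigenbasis hnm U V * Matrix.diagonal fun t => (augEigenvalue m σ t : 𝕜) := by
  have hdiag : (Matrix.diagonal fun t => (augEigenvalue m σ t : 𝕜)) =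
      Matrix.fromBlocks (Matrix.diagonal fun i => (σ i : 𝕜)) 0 0
        (Matrix.fromBlocks (-Matrix.diagonal fun i => (σ i : 𝕜)) 0 0 0) := by
    rw [Matrix.diagonal_neg, ← Matrix.diagonal_zero, Matrix.fromBlocks_diagonal,
      Matrix.fromBlocks_diagonal]
    congr 1
    ext t
    rcases t with t | t | t <;> simp [augEigenvalue]
  rw [hdiag]
  simp only [augEigenbasis, augmented, Matrix.mul_fromCols, Matrix.mul_smul,
    Matrix.fromBlocks_mul_fromRows, Matrix.fromCols_mul_fromBlocks, h.mul_right_eq_leftHead hnm,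
    h.conjTranspose_mul_leftHead hnm, h.conjTranspose_mul_leftTail, Matrix.smul_mul,
    Matrix.fromRows_mul, Matrix.mul_zero, Matrix.zero_mul, zero_add, add_zero, Matrix.mul_neg,
    Matrix.neg_mul, Matrix.fromRows_zero]
  simp [smul_fromRows, Matrix.fromRows_neg]

theorem approxProjector_mul_augEigenbasis (hnm : n ≤ m) {A : Matrix (Fin m) (Fin n) 𝕜} (a b : ℝ)
    (d : ℕ) {U : Matrix (Fin m) (Fin m) 𝕜} {σ : Fin n → ℝ} {V : Matrix (Fin n) (Fin n) 𝕜}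
    (h : IsSVD A U σ V) :
    approxProjector A a b d * augEigenbasis hnm U V = augEigenbasis hnm U V *
      Matrix.diagonal fun t => (filterValue A a b d (augEigenvalue m σ t) : 𝕜) := by
  refine aeval_mul_eq_mul_diagonal (lam := fun t => augEigenvalue m σ t / ‖A‖) ?_ _
  rw [Matrix.smul_mul, augmented_mul_augEigenbasis hnm h, ← Matrix.mul_smul]
  congr 1
  ext i j
  by_cases hij : i = j
  · subst hij; simp [RCLike.real_smul_eq_coe_mul, div_eq_inv_mul]
  · simp [hij]

theorem IsSVD.le_norm (hnm : n ≤ m) {A : Matrix (Fin m) (Fin n) 𝕜}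
    {U : Matrix (Fin m) (Fin m) 𝕜} {σ : Fin n → ℝ} {V : Matrix (Fin n) (Fin n) 𝕜}
    (h : IsSVD A U σ V) (i : Fin n) : σ i ≤ ‖A‖ := by
  have hV : Vᴴ * V = 1 := Matrix.mem_unitaryGroup_iff'.mp h.unitary_right
  have hU1 := leftHead_orthonormal hnm (U := U) (Matrix.mem_unitaryGroup_iff'.mp h.unitary_left)
  have e : (leftHead hnm U)ᴴ * (A * V) = Matrix.diagonal fun i => (σ i : 𝕜) := by
    rw [h.mul_right_eq_leftHead hnm, ← Matrix.mul_assoc, hU1, Matrix.one_mul]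
  calc σ i ≤ ‖(σ i : 𝕜)‖ := by rw [RCLike.norm_ofReal]; exact le_abs_self _
    _ ≤ ‖fun i => (σ i : 𝕜)‖ := norm_le_pi_norm (fun i => (σ i : 𝕜)) i
    _ = ‖(leftHead hnm U)ᴴ * (A * V)‖ := by rw [e, Matrix.l2_opNorm_diagonal]
    _ ≤ ‖(leftHead hnm U)ᴴ‖ * ‖A * V‖ := Matrix.l2_opNorm_mul _ _
    _ ≤ ‖A * V‖ := mul_le_of_le_one_left (norm_nonneg _) (norm_conjTranspose_le_one hU1)
    _ ≤ ‖A‖ * ‖V‖ := Matrix.l2_opNorm_mul _ _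
    _ ≤ ‖A‖ := mul_le_of_le_one_right (norm_nonneg _) (norm_le_one_of_orthonormal hV)

/-- The approximate projector is positive semidefinite: all its eigenvalues are values of the
Chebyshev--Jackson series on `[-1, 1]`. -/
theorem filterValue_augEigenvalue_nonneg (hnm : n ≤ m) {A : Matrix (Fin m) (Fin n) 𝕜} {a b : ℝ}
    (hab : a ≤ b) (d : ℕ) {U : Matrix (Fin m) (Fin m) 𝕜} {σ : Fin n → ℝ}
    {V : Matrix (Fin n) (Fin n) 𝕜} (h : IsSVD A U σ V) (t : Fin n ⊕ Fin n ⊕ Fin (m - n)) :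
    0 ≤ filterValue A a b d (augEigenvalue m σ t) := by
  have habs : |augEigenvalue m σ t| ≤ ‖A‖ := by
    rcases t with t | t | t
    · simpa [augEigenvalue, abs_of_nonneg (h.nonneg t)] using h.le_norm hnm t
    · simpa [augEigenvalue, abs_of_nonneg (h.nonneg t)] using h.le_norm hnm t
    · simp [augEigenvalue]
  refine eval_chebyshevJackson_nonneg (by gcongr) d (abs_le.mp ?_)
  rw [abs_div, abs_norm]
  exact div_le_one_of_le₀ habs (norm_nonneg _)

end

/-! ### Convergence of subspace iteration -/

section
variable {𝕜 : Type*} [RCLike 𝕜]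

/-- Subspace iteration with a matrix `P` diagonalized by an orthonormal basis `W`. In the
coordinates of `W` and normalized by their leading `p × p` block `B k`, the iterates have the
entries `(γ t / γ (e i)) ^ k * M₀ t i`, with the identity as leading block; all other entries
decay geometrically. Invertibility of `B k` is preserved because the leading eigenvalues are
nonzero. -/
theorem tendsto_subspaceIteration {ι κ s : Type*} [Fintype ι] [DecidableEq ι] [Fintype κ]
    [DecidableEq κ] [Fintype s] [DecidableEq s] {P : Matrix ι ι 𝕜} {W : Matrix ι s 𝕜}
    (hW : Wᴴ * W = 1) (hW' : W * Wᴴ = 1) {γ : s → ℝ}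
    (hP : P * W = W * Matrix.diagonal fun t => (γ t : 𝕜)) {e : κ → s}
    (he : Function.Injective e) (hpos : ∀ i, 0 < γ (e i))
    (hgap : ∀ i, ∀ t ∉ Set.range e, |γ t| < γ (e i)) {Q : ℕ → Matrix ι κ 𝕜}
    {R : ℕ → Matrix κ κ 𝕜} (hQ : ∀ k, (Q k)ᴴ * Q k = 1)
    (hiter : ∀ k, P * Q k = Q (k + 1) * R k) (hinv : IsUnit ((W.submatrix id e)ᴴ * Q 0)) :
    Filter.Tendsto (fun k => ‖Q k - W.submatrix id e * ((W.submatrix id e)ᴴ * Q k)‖)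
      Filter.atTop (nhds 0) := by
  set Qp := W.submatrix id e with hQp
  have hQpo : Qpᴴ * Qp = 1 := by
    rw [hQp, conjTranspose_submatrix_mul_submatrix, hW]
    exact Matrix.submatrix_one _ he
  have hWP : Wᴴ * P = (Matrix.diagonal fun t => (γ t : 𝕜)) * Wᴴ := by
    calc Wᴴ * P = Wᴴ * (P * W) * Wᴴ := by
          rw [Matrix.mul_assoc, Matrix.mul_assoc P, hW', Matrix.mul_one]
      _ = _ := by rw [hP, ← Matrix.mul_assoc, hW, Matrix.one_mul]
  set B : ℕ → Matrix κ κ 𝕜 := fun k => Qpᴴ * Q k with hB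
  have hG : ∀ k, (Matrix.diagonal fun t => (γ t : 𝕜)) * (Wᴴ * Q k) = Wᴴ * Q (k + 1) * R k := by
    intro k
    rw [← Matrix.mul_assoc, ← hWP, Matrix.mul_assoc, hiter, Matrix.mul_assoc]
  have hBsub : ∀ k, B k = (Wᴴ * Q k).submatrix e id := by
    intro k
    ext i j
    simp [hB, hQp, Matrix.mul_apply]
  have hBR : ∀ k, (Matrix.diagonal fun i => (γ (e i) : 𝕜)) * B k = B (k + 1) * R k := by
    intro k
    have h1 := congrArg (fun M => M.submatrix e id) (hG k)
    ext i j
    have h2 := congrFun (congrFun h1 i) j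
    simp only [Matrix.submatrix_apply, Matrix.diagonal_mul, id] at h2
    rw [Matrix.diagonal_mul, hBsub, Matrix.submatrix_apply, id, h2, hBsub (k + 1)]
    simp [Matrix.mul_apply]
  have hdu : IsUnit (Matrix.diagonal fun i => (γ (e i) : 𝕜)) := by
    rw [Matrix.isUnit_diagonal, Pi.isUnit_iff]
    intro i
    exact isUnit_iff_ne_zero.mpr (RCLike.ofReal_ne_zero.mpr (hpos i).ne')
  have hunit : ∀ k, IsUnit (B k) := by
    intro k
    induction k with
    | zero => exact hinv
    | succ k ih =>
      have := hdu.mul ih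
      rw [hBR k] at this
      exact isUnit_of_mul_isUnit_left this
  have hRunit : ∀ k, IsUnit (R k) := by
    intro k
    have := hdu.mul (hunit k)
    rw [hBR k] at this
    exact isUnit_of_mul_isUnit_right this
  obtain ⟨M₀, hM₀⟩ : ∃ M₀ : Matrix s κ 𝕜, Wᴴ * Q 0 = M₀ * B 0 := by
    obtain ⟨u, hu⟩ := hunit 0
    refine ⟨Wᴴ * Q 0 * (↑u⁻¹ : Matrix κ κ 𝕜), ?_⟩
    rw [← hu, Matrix.mul_assoc, Units.inv_mul, Matrix.mul_one]
  have htop : M₀.submatrix e id = 1 := by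
    refine (hunit 0).mul_right_cancel ?_
    rw [one_mul]
    conv_rhs => rw [hBsub, hM₀]
    ext i j
    simp [Matrix.mul_apply]
  let M : ℕ → Matrix s κ 𝕜 := fun k => Matrix.of fun t i =>
    ((γ t / γ (e i) : ℝ) : 𝕜) ^ k * M₀ t i
  have hM : ∀ k, Wᴴ * Q k = M k * B k := by
    intro k
    induction k with
    | zero =>
      have : M 0 = M₀ := by ext t i; simp [M]
      rw [this, hM₀]
    | succ k ih =>
      have h1 : (Matrix.diagonal fun t => (γ t : 𝕜)) * M k =
          M (k + 1) * Matrix.diagonal fun i => (γ (e i) : 𝕜) := by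
        ext t i
        have h0 : (γ (e i) : 𝕜) ≠ 0 := RCLike.ofReal_ne_zero.mpr (hpos i).ne'
        simp only [Matrix.diagonal_mul, Matrix.mul_diagonal, M, Matrix.of_apply, pow_succ,
          RCLike.ofReal_div]
        field_simp
      have h2 : Wᴴ * Q (k + 1) * R k = M (k + 1) * B (k + 1) * R k := by
        rw [← hG, ih, ← Matrix.mul_assoc, h1, Matrix.mul_assoc, hBR,
          Matrix.mul_assoc (M (k + 1)) (B (k + 1))]
      obtain ⟨u, hu⟩ := hRunit k
      have h3 := congrArg (fun X => X * (↑u⁻¹ : Matrix κ κ 𝕜)) h2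
      simpa only [← hu, Matrix.mul_assoc, Units.mul_inv, Matrix.mul_one] using h3
  have hN : ∀ t i, (Wᴴ * Qp) t i = if t = e i then 1 else 0 := by
    intro t i
    have : Wᴴ * Qp = (Wᴴ * W).submatrix id e := conjTranspose_submatrix_mul_submatrix W id e
    rw [this, hW, Matrix.submatrix_apply, Matrix.one_apply, id]
  have hlim : Filter.Tendsto M Filter.atTop (nhds (Wᴴ * Qp)) := by
    refine tendsto_pi_nhds.mpr fun t => tendsto_pi_nhds.mpr fun i => ?_
    rw [hN]
    by_cases ht : t ∈ Set.range e
    · obtain ⟨j, rfl⟩ := ht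
      have h1 : M₀ (e j) i = (1 : Matrix κ κ 𝕜) j i := by rw [← htop]; rfl
      refine tendsto_const_nhds.congr fun k => ?_
      by_cases hji : j = i
      · subst hji
        simp [M, h1, (hpos j).ne']
      · simp [M, h1, hji, he.eq_iff]
    · have h1 : t ≠ e i := fun h => ht ⟨i, h.symm⟩
      rw [if_neg h1]
      have h2 : ‖((γ t / γ (e i) : ℝ) : 𝕜)‖ < 1 := by
        rw [RCLike.norm_ofReal, abs_div, abs_of_pos (hpos i), div_lt_one (hpos i)]
        exact hgap i t ht
      simpa [M] using (tendsto_pow_atTop_nhds_zero_of_norm_lt_one h2).mul_const (M₀ t i)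
  have hlim' : Filter.Tendsto (fun k => ‖M k - Wᴴ * Qp‖) Filter.atTop (nhds 0) :=
    tendsto_iff_norm_sub_tendsto_zero.mp hlim
  refine squeeze_zero (fun _ => norm_nonneg _) (fun k => ?_) hlim'
  have hsplit : Q k - Qp * (Qpᴴ * Q k) = W * ((M k - Wᴴ * Qp) * B k) := by
    rw [Matrix.sub_mul, ← hM k, Matrix.mul_sub, ← Matrix.mul_assoc W, hW', Matrix.one_mul,
      ← Matrix.mul_assoc W, ← Matrix.mul_assoc W, hW', Matrix.one_mul]
  rw [hsplit]
  have hBn : ‖B k‖ ≤ 1 := (Matrix.l2_opNorm_mul _ _).trans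
    (mul_le_one₀ (norm_conjTranspose_le_one hQpo) (norm_nonneg _)
      (norm_le_one_of_orthonormal (hQ k)))
  calc _ ≤ ‖W‖ * ‖(M k - Wᴴ * Qp) * B k‖ := Matrix.l2_opNorm_mul _ _
    _ ≤ ‖(M k - Wᴴ * Qp) * B k‖ :=
      mul_le_of_le_one_left (norm_nonneg _) (norm_le_one_of_orthonormal hW)
    _ ≤ ‖M k - Wᴴ * Qp‖ * ‖B k‖ := Matrix.l2_opNorm_mul _ _
    _ ≤ ‖M k - Wᴴ * Qp‖ := mul_le_of_le_one_right (norm_nonneg _) hBn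

variable {m n p : ℕ}

theorem IsSolverRun.orthonormal {A : Matrix (Fin m) (Fin n) 𝕜} {a b : ℝ} {d : ℕ}
    {Qt : ℕ → Matrix (Fin n ⊕ Fin m) (Fin p) 𝕜} {σt : ℕ → Fin p → ℝ}
    {Ut : ℕ → Matrix (Fin m) (Fin p) 𝕜} {Vt : ℕ → Matrix (Fin n) (Fin p) 𝕜}
    (h : IsSolverRun A a b d Qt σt Ut Vt) (k : ℕ) : (Qt k)ᴴ * Qt k = 1 := by
  cases k with
  | zero => exact h.init
  | succ k => exact (h.iterate k).choose_spec.orthonormal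

theorem leadingEigenvectors_orthonormal (hnm : n ≤ m) (hpn : p ≤ n)
    {U : Matrix (Fin m) (Fin m) 𝕜} {V : Matrix (Fin n) (Fin n) 𝕜} (hU : Uᴴ * U = 1)
    (hV : Vᴴ * V = 1) :
    (leadingEigenvectors hnm hpn U V)ᴴ * leadingEigenvectors hnm hpn U V = 1 := by
  rw [leadingEigenvectors_eq_submatrix, conjTranspose_submatrix_mul_submatrix,
    augEigenbasis_orthonormal hnm hU hV]
  exact Matrix.submatrix_one _ (Sum.inl_injective.comp (Fin.castLE_injective hpn))

theorem tendsto_subspaceDist_of_isSolverRun (hnm : n ≤ m) (hpn : p ≤ n)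
    {A : Matrix (Fin m) (Fin n) 𝕜} {a b : ℝ} (hab : a ≤ b) {d : ℕ}
    {U : Matrix (Fin m) (Fin m) 𝕜} {σ : Fin n → ℝ} {V : Matrix (Fin n) (Fin n) 𝕜}
    (hsvd : IsSVD A U σ V) (hgap : DominantGap A a b d σ p)
    {Qt : ℕ → Matrix (Fin n ⊕ Fin m) (Fin p) 𝕜} {σt : ℕ → Fin p → ℝ}
    {Ut : ℕ → Matrix (Fin m) (Fin p) 𝕜} {Vt : ℕ → Matrix (Fin n) (Fin p) 𝕜}
    (hrun : IsSolverRun A a b d Qt σt Ut Vt)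
    (hinv : IsUnit ((leadingEigenvectors hnm hpn U V)ᴴ * Qt 0)) :
    Filter.Tendsto (fun k => subspaceDist (colSpan (Qt k))
      (colSpan (leadingEigenvectors hnm hpn U V))) Filter.atTop (nhds 0) := by
  have hU : Uᴴ * U = 1 := Matrix.mem_unitaryGroup_iff'.mp hsvd.unitary_left
  have hV : Vᴴ * V = 1 := Matrix.mem_unitaryGroup_iff'.mp hsvd.unitary_right
  have hW := augEigenbasis_orthonormal hnm hU hV
  have hcard : Fintype.card (Fin n ⊕ Fin m) = Fintype.card (Fin n ⊕ Fin n ⊕ Fin (m - n)) := by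
    simp only [Fintype.card_sum, Fintype.card_fin]; omega
  have hW' := (Matrix.mul_eq_one_comm_of_card_eq _ _ _ hcard).mpr hW
  have hnonneg := filterValue_augEigenvalue_nonneg hnm hab d hsvd
  choose R hR using hrun.iterate
  rw [leadingEigenvectors_eq_submatrix] at hinv
  have hconv := tendsto_subspaceIteration hW hW' (approxProjector_mul_augEigenbasis hnm a b d hsvd)
    (Sum.inl_injective.comp (Fin.castLE_injective hpn))
    (fun i => by
      -- `-σ i` is one of the eigenvalues outside the leading group, with a nonnegative filter value.
      refine (hnonneg (Sum.inr (Sum.inl (Fin.castLE hpn i)))).trans_lt ?_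
      exact hgap (Fin.castLE hpn i) (by simp) _ (by simp))
    (fun i t ht => by
      rw [abs_of_nonneg (hnonneg t)]
      refine hgap (Fin.castLE hpn i) (by simp) t fun j hj => ?_
      by_contra hlt
      exact ht ⟨⟨j, not_le.mp hlt⟩, by rw [hj]; rfl⟩)
    hrun.orthonormal (fun k => (hR k).eq) hinv
  have hQp := leadingEigenvectors_orthonormal hnm hpn hU hV
  have h2 := hconv.const_mul 2
  rw [mul_zero] at h2
  refine squeeze_zero (fun _ => norm_nonneg _) (fun k => ?_) h2
  have h3 := subspaceDist_le_two_mul (hrun.orthonormal k) hQp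
  rw [leadingEigenvectors_eq_submatrix] at h3 ⊢
  exact h3

/-- The residual bound for the Ritz triplets of an arbitrary orthonormal basis. -/
theorem norm_svdResidual_le_subspaceDist (hnm : n ≤ m) (hpn : p ≤ n)
    {A : Matrix (Fin m) (Fin n) 𝕜} {U : Matrix (Fin m) (Fin m) 𝕜} {σ : Fin n → ℝ}
    {V : Matrix (Fin n) (Fin n) 𝕜} (hsvd : IsSVD A U σ V)
    {Qt : Matrix (Fin n ⊕ Fin m) (Fin p) 𝕜} (hQt : Qtᴴ * Qt = 1) {σt : Fin p → ℝ}
    {Ut : Matrix (Fin m) (Fin p) 𝕜} {Vt : Matrix (Fin n) (Fin p) 𝕜}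
    (hR : IsRitzOutput A Qt σt Ut Vt) (i : Fin p) :
    ‖svdResidual A (σt i) (fun r => Ut r i) (fun r => Vt r i)‖ ≤
      4 * ‖A‖ * subspaceDist (colSpan Qt) (colSpan (leadingEigenvectors hnm hpn U V)) := by
  have hU : Uᴴ * U = 1 := Matrix.mem_unitaryGroup_iff'.mp hsvd.unitary_left
  have hV : Vᴴ * V = 1 := Matrix.mem_unitaryGroup_iff'.mp hsvd.unitary_right
  have hUp : (U.submatrix id (Fin.castLE (hpn.trans hnm)))ᴴ *
      U.submatrix id (Fin.castLE (hpn.trans hnm)) = 1 := by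
    rw [conjTranspose_submatrix_mul_submatrix, hU]
    exact Matrix.submatrix_one _ (Fin.castLE_injective _)
  have hVp : (V.submatrix id (Fin.castLE hpn))ᴴ * V.submatrix id (Fin.castLE hpn) = 1 := by
    rw [conjTranspose_submatrix_mul_submatrix, hV]
    exact Matrix.submatrix_one _ (Fin.castLE_injective _)
  refine norm_svdResidual_le hUp hVp
    (D := Matrix.diagonal fun i => (σ (Fin.castLE hpn i) : 𝕜)) ?_ ?_ rfl
    (norm_sub_proj_le_subspaceDist hQt (leadingEigenvectors_orthonormal hnm hpn hU hV)) hR i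
  · ext r j
    have h := congrFun (congrFun (hsvd.mul_right_eq_leftHead hnm) r) (Fin.castLE hpn j)
    rw [Matrix.mul_diagonal] at h ⊢
    exact h
  · ext r j
    have h := congrFun (congrFun (hsvd.conjTranspose_mul_leftHead hnm) r) (Fin.castLE hpn j)
    rw [Matrix.mul_diagonal] at h ⊢
    exact h

end
end CJFeast

theorem mainTheorem5 {𝕜 : Type*} [RCLike 𝕜] {m n p : ℕ} (hnm : n ≤ m) (hpn : p ≤ n)
    (A : Matrix (Fin m) (Fin n) 𝕜) (a b : ℝ) (ha : 0 < a) (hab : a ≤ b) (hb : b ≤ ‖A‖) (d : ℕ)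
    (U : Matrix (Fin m) (Fin m) 𝕜) (σ : Fin n → ℝ) (V : Matrix (Fin n) (Fin n) 𝕜)
    (hsvd : CJFeast.IsSVD A U σ V) (hgap : CJFeast.DominantGap A a b d σ p)
    (Qt : ℕ → Matrix (Fin n ⊕ Fin m) (Fin p) 𝕜) (σt : ℕ → Fin p → ℝ)
    (Ut : ℕ → Matrix (Fin m) (Fin p) 𝕜) (Vt : ℕ → Matrix (Fin n) (Fin p) 𝕜)
    (hrun : CJFeast.IsSolverRun A a b d Qt σt Ut Vt)
    (hinv : IsUnit ((CJFeast.leadingEigenvectors hnm hpn U V)ᴴ * Qt 0)) :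
    (∀ k, 1 ≤ k → ∀ i : Fin p,
      ‖CJFeast.svdResidual A (σt k i) (fun r => Ut k r i) (fun r => Vt k r i)‖ ≤
        4 * ‖A‖ * CJFeast.subspaceDist (CJFeast.colSpan (Qt k))
          (CJFeast.colSpan (CJFeast.leadingEigenvectors hnm hpn U V))) ∧
    CJFeast.StableUnderSubspaceError A (CJFeast.leadingEigenvectors hnm hpn U V) 4 ∧
    Filter.Tendsto (fun k => CJFeast.subspaceDist (CJFeast.colSpan (Qt k))
      (CJFeast.colSpan (CJFeast.leadingEigenvectors hnm hpn U V))) Filter.atTop (nhds 0) ∧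
    CJFeast.ReachesPrecision A σt Ut Vt 4 := by
  have hA : 0 < ‖A‖ := (ha.trans_le hab).trans_le hb
  have hconv := CJFeast.tendsto_subspaceDist_of_isSolverRun hnm hpn hab hsvd hgap hrun hinv
  have hres : ∀ k, 1 ≤ k → ∀ i : Fin p,
      ‖CJFeast.svdResidual A (σt k i) (fun r => Ut k r i) (fun r => Vt k r i)‖ ≤
        4 * ‖A‖ * CJFeast.subspaceDist (CJFeast.colSpan (Qt k))
          (CJFeast.colSpan (CJFeast.leadingEigenvectors hnm hpn U V)) := fun k hk i =>
    CJFeast.norm_svdResidual_le_subspaceDist hnm hpn hsvd (hrun.orthonormal k) (hrun.ritz k hk) i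
  refine ⟨hres, ?_, hconv, ?_⟩
  · intro C εmach _ _ Qh hQh hdist σh Uh Vh hR i
    have h := CJFeast.norm_svdResidual_le_subspaceDist hnm hpn hsvd hQh hR i
    rw [div_le_iff₀ hA]
    calc _ ≤ _ := h
      _ ≤ 4 * ‖A‖ * (C * εmach) := by gcongr
      _ = 4 * C * εmach * ‖A‖ := by ring
  · intro εmach hε
    filter_upwards [hconv.eventually (eventually_le_nhds hε), Filter.eventually_ge_atTop 1]
      with k hk hk1 i
    rw [div_le_iff₀ hA]
    calc _ ≤ _ := hres k hk1 i
      _ ≤ 4 * ‖A‖ * εmach := by gcongr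
      _ = 4 * εmach * ‖A‖ := by ring
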